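/- **Model.** A network is a finite connected simple graph $G=(V,E)$ in which every node $v$ has ports $1,\dots,\deg(v)$, each leading to exactly one neighbour (the numberings at the two ends of an edge are unrelated), and in which the nodes have distinct identifiers. Computation proceeds in synchronous rounds; all nodes start simultaneously. A node knows the number of nodes of the network, its own degree and identifier, whether it is the source (and, if it is, the source message), its own private infinite string of independent fair random bits (independent over the nodes), and the messages received so far on each of its ports; from these it determines which messages (finite bit strings of any length, at most one per port and round) to send, and its current output. Initially it knows nothing about its neighbours. A randomized broadcast algorithm, for a set $P$ of at least two possible source messages, succeeds in an execution if from some round on every node outputs the source message. It *succeeds with probability $1-o(1)$* if there is $\delta(m)\to 0$ such that on every $m$-node network whose identifiers lie in a given set $I_m\subseteq\mathbb N$ (where $|I_m|\ge m$), for every source node and every source message, it succeeds with probability at least $1-\delta(m)$. (Algorithms for anonymous nodes are those that ignore the identifiers.) The conductance of $G$ is $$\phi(G)=\min_{\emptyset\ne U\subsetneq V}\frac{|E(U,V\setminus U)|}{\min\{\mathrm{Vol}(U),\mathrm{Vol}(V\setminus U)\}},\qquad \mathrm{Vol}(U)=\sum_{v\in U}\deg(v).$$ **Statement.** There are absolute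 constants $c_1,\dots,c_5>0$ such that the following holds for all $P$ and $(I_m)_m$ as above. Let $A$ be a randomized broadcast algorithm that succeeds with probability $1-o(1)$. Then there is $n_0$ such that for every $n\ge n_0$ and every real $\alpha$ with $\frac1{n^2}<\alpha<\frac1{12^2}$ there is a network with underlying graph $G$ and identifiers in $I_{|V(G)|}$ such that $$c_1 n\le |V(G)|\le c_2 n,\qquad c_3\alpha\le\phi(G)\le c_4\alpha,$$ and such that for some source node and some source message the expected total number of messages sent by $A$ on this network is at least $c_5\,n/\sqrt{\phi(G)}$. -/

import Mathlib

open MeasureTheory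

noncomputable section

namespace BroadcastLB

/-! ### Conductance of a finite graph -/

/-- The volume of a set of vertices: the sum of the degrees. -/
def vol {V : Type} [Fintype V] (G : SimpleGraph V) (U : Finset V) : ℕ :=
  ∑ v ∈ U, (G.neighborSet v).ncard

/-- The number of edges between `U` and its complement (each such edge corresponds to exactly one
ordered pair `(u, v)` with `u ∈ U`, `v ∉ U`). -/
def cutEdges {V : Type} [Fintype V] (G : SimpleGraph V) (U : Finset V) : ℕ :=
  {e : V × V | e.1 ∈ U ∧ e.2 ∉ U ∧ G.Adj e.1 e.2}.ncard

open Classical in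
/-- The conductance of the cut `(U, V \ U)`. -/
def cutConductance {V : Type} [Fintype V] (G : SimpleGraph V) (U : Finset V) : ℝ :=
  (cutEdges G U : ℝ) / (min (vol G U) (vol G Uᶜ) : ℕ)

/-- The conductance of a graph: the minimum of the cut conductances over all cuts with two
nonempty sides (an infimum over a finite set, nonempty as soon as there are two vertices). -/
def conductance {V : Type} [Fintype V] (G : SimpleGraph V) : ℝ :=
  ⨅ U : {U : Finset V // U.Nonempty ∧ U ≠ Finset.univ}, cutConductance G U.1

/-! ### Networks -/

/-- A network of `m` nodes: a connected simple graph, together with a numbering of the ports of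
each node (a bijection between its port numbers and its neighbours, chosen independently at the
two ends of an edge) and with distinct node identifiers. -/
structure Network (m : ℕ) where
  graph : SimpleGraph (Fin m)
  connected : graph.Connected
  /-- The degree of a node (this is forced by `port`). -/
  deg : Fin m → ℕ
  port : ∀ v : Fin m, Fin (deg v) ≃ graph.neighborSet v
  id : Fin m → ℕ
  id_injective : Function.Injective id

/-- Messages are finite bit strings; their length is not restricted. -/
abbrev Msg : Type := List Bool

/-- What a node of degree `d` receives in one round: at most one message on each of its ports. -/
abbrev Inbox (d : ℕ) : Type := Fin d → Option Msg

/-- The private random tape of a node: an infinite bit string. -/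
abbrev Tape : Type := ℕ → Bool

/-! ### Algorithms -/

/-- A randomized distributed broadcast algorithm for synchronous networks; `P` is the set of
possible source messages.  All that a node knows in a round is the network size `n`, its own
degree `d`, its own identifier `id`, its input `x : Option P` (`some p` if it is the source and `p`
is to be broadcast, `none` if it is not the source), its private random tape, and what it received
on its ports in all earlier rounds (most recent round first; the length of the list is the number
of the round).  As a function of this, it decides for each of its ports whether to send a message,
and which one, and what its present output is (`none`: no output yet).  Local computation and
memory are unrestricted.  The last two fields only say that the decisions are measurable functions
of the random tape. -/
structure Algorithm (P : Type) where
  send : (n d id : ℕ) → (x : Option P) → Tape → List (Inbox d) → Fin d → Option Msg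
  output : (n d id : ℕ) → (x : Option P) → Tape → List (Inbox d) → Option P
  measurableSet_send : ∀ (n d id : ℕ) (x : Option P) (h : List (Inbox d)) (i : Fin d) (a : Msg),
    MeasurableSet {τ : Tape | send n d id x τ h i = some a}
  measurableSet_output : ∀ (n d id : ℕ) (x : Option P) (h : List (Inbox d)) (p : P),
    MeasurableSet {τ : Tape | output n d id x τ h = some p}

section Execution

variable {P : Type} {m : ℕ}

/-- The input of node `v` when `src` is the source and `p` the message to be broadcast. -/
def input (src : Fin m) (p : P) (v : Fin m) : Option P :=
  if v = src then some p else none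

/-- The port of `u` that leads to `v`, where `u` is the neighbour of `v` at the port `i` of `v`. -/
def Network.backPort (N : Network m) (v : Fin m) (i : Fin (N.deg v)) :
    Fin (N.deg (N.port v i).1) :=
  (N.port (N.port v i).1).symm ⟨v, (N.graph.mem_neighborSet _ _).2
    (((N.graph.mem_neighborSet _ _).1 (N.port v i).2).symm)⟩

/-- The inboxes of node `v` in the rounds before round `t`, most recent first, in the execution of
`A` on `N` with source `src`, source message `p` and random tapes `ω`.  All nodes start in round
`0`, and a message sent in round `t` is available to its receiver from round `t + 1` on. -/
def history (A : Algorithm P) (N : Network m) (src : Fin m) (p : P) (ω : Fin m → Tape) :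
    ℕ → (v : Fin m) → List (Inbox (N.deg v))
  | 0, _ => []
  | t + 1, v =>
    (fun i : Fin (N.deg v) =>
      A.send m (N.deg (N.port v i).1) (N.id (N.port v i).1) (input src p (N.port v i).1)
        (ω (N.port v i).1) (history A N src p ω t (N.port v i).1) (N.backPort v i)) ::
      history A N src p ω t v

/-- What node `v` sends over its port `i` in round `t`. -/
def sent (A : Algorithm P) (N : Network m) (src : Fin m) (p : P) (ω : Fin m → Tape)
    (t : ℕ) (v : Fin m) (i : Fin (N.deg v)) : Option Msg :=
  A.send m (N.deg v) (N.id v) (input src p v) (ω v) (history A N src p ω t v) i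

/-- The output of node `v` in round `t`. -/
def outputAt (A : Algorithm P) (N : Network m) (src : Fin m) (p : P) (ω : Fin m → Tape)
    (t : ℕ) (v : Fin m) : Option P :=
  A.output m (N.deg v) (N.id v) (input src p v) (ω v) (history A N src p ω t v)

/-- The total number of messages sent during the whole execution (possibly infinite). -/
def messages (A : Algorithm P) (N : Network m) (src : Fin m) (p : P) (ω : Fin m → Tape) : ENNReal :=
  ∑' t : ℕ, ∑ v : Fin m, ∑ i : Fin (N.deg v),
    if (sent A N src p ω t v i).isSome then 1 else 0

/-- The broadcast succeeds: from some round on, every node outputs the source message. -/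
def Succeeds (A : Algorithm P) (N : Network m) (src : Fin m) (p : P) (ω : Fin m → Tape) : Prop :=
  ∃ T : ℕ, ∀ t ≥ T, ∀ v : Fin m, outputAt A N src p ω t v = some p

end Execution

/-- The law of one random tape: independent fair coin flips. -/
def tapeLaw : Measure Tape :=
  Measure.infinitePi fun _ : ℕ => (PMF.uniformOfFintype Bool).toMeasure

/-- The joint law of the tapes of `m` nodes: independent tapes. -/
def tapesLaw (m : ℕ) : Measure (Fin m → Tape) :=
  Measure.pi fun _ : Fin m => tapeLaw

/-- The probability that the broadcast succeeds. -/
def successProb {P : Type} {m : ℕ} (A : Algorithm P) (N : Network m) (src : Fin m) (p : P) : ℝ :=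
  (tapesLaw m).real {ω | Succeeds A N src p ω}

/-- The expected number of messages. -/
def expectedMessages {P : Type} {m : ℕ} (A : Algorithm P) (N : Network m) (src : Fin m) (p : P) :
    ENNReal :=
  ∫⁻ ω, messages A N src p ω ∂(tapesLaw m)

/-- `A` is a broadcast algorithm with success probability `1 - o(1)` for networks whose identifiers
are taken from the sets `I m`: on every such network of `m` nodes, for every source and every source
message, it succeeds with probability at least `1 - δ m`, where `δ m → 0` as `m → ∞`. -/
def IsBroadcastAlgorithm {P : Type} (I : ℕ → Set ℕ) (A : Algorithm P) : Prop :=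
  ∃ δ : ℕ → ℝ, Filter.Tendsto δ Filter.atTop (nhds 0) ∧
    ∀ (m : ℕ) (N : Network m), (∀ v, N.id v ∈ I m) →
      ∀ (src : Fin m) (p : P), 1 - δ m ≤ successProb A N src p

end BroadcastLB

end

open MeasureTheory

noncomputable section

namespace BroadcastLB

/-! ### Executions along dart maps

A dart is a node together with one of its ports.  An execution only depends on the map that sends
a dart to the dart at the other end of its edge, and it makes sense for every self-map of the
darts. -/

/-! The hard networks have a hub and about `n / s` gadgets, with `s` about `1 / √α`. A gadget
consists of two copies of `K_{s,s}`; the hub is joined to one side of the first copy. In each gadget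
one of the `s²` labels `(x, y)` is hidden: the edge `xy` of the first copy and its twin in the
second are exchanged for two edges between the copies. Ports are transported along this exchange, so
degrees, ports and identifiers reveal nothing about the label. The second copy is a cut of two edges
against volume of order `s²`, and no cut is better by more than a constant factor, so the
conductance is of order `1 / s²`.

Fix the tapes and all labels except that of gadget `i`, and compare with the reference execution in
which nothing is exchanged there. Hiding `ℓ` changes nothing until a message is sent on an edge
labelled `ℓ`. A label used neither for message `p` nor for message `q` in the reference execution
leaves the second copy unable to tell `p` from `q` (`HiddenFamily.mem_or_mem_usedLabels`). So the
number of labels used in these two executions together is at least the number of labels for which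
both broadcasts succeed. Moreover, with `ℓ` hidden, every label used no later than `ℓ` in the
reference execution is still used. Hence `a` used labels in the reference execution give at least
`a² / 2` used labels in total over all choices of `ℓ` (`card_usedLabels_sq_le`).

Averaging over labels and tapes, an algorithm that mostly succeeds uses order `s²` labels per
gadget, and distinct labels need distinct messages. This gives order `k s²` messages for `k`
gadgets, that is, `n s`, or `n / √φ` (`HiddenFamily.exists_expectedMessages_ge`). -/

/-- A node together with one of its ports. -/
abbrev Dart {m : ℕ} (deg : Fin m → ℕ) : Type := Σ v : Fin m, Fin (deg v)

section Exec

variable {P : Type} {m : ℕ} {deg : Fin m → ℕ}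

/-- The histories in the execution in which the messages received at the dart `d` are those sent
at the dart `R d`. -/
def exec (A : Algorithm P) (id : Fin m → ℕ) (x : Fin m → Option P) (R : Dart deg → Dart deg)
    (ω : Fin m → Tape) : ℕ → (v : Fin m) → List (Inbox (deg v))
  | 0, _ => []
  | t + 1, v =>
    (fun i : Fin (deg v) =>
      A.send m (deg (R ⟨v, i⟩).1) (id (R ⟨v, i⟩).1) (x (R ⟨v, i⟩).1) (ω (R ⟨v, i⟩).1)
        (exec A id x R ω t (R ⟨v, i⟩).1) (R ⟨v, i⟩).2) :: exec A id x R ω t v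

/-- What is sent at the dart `d` in round `t`. -/
def execSent (A : Algorithm P) (id : Fin m → ℕ) (x : Fin m → Option P) (R : Dart deg → Dart deg)
    (ω : Fin m → Tape) (t : ℕ) (d : Dart deg) : Option Msg :=
  A.send m (deg d.1) (id d.1) (x d.1) (ω d.1) (exec A id x R ω t d.1) d.2

lemma exec_succ (A : Algorithm P) (id : Fin m → ℕ) (x : Fin m → Option P)
    (R : Dart deg → Dart deg) (ω : Fin m → Tape) (t : ℕ) (v : Fin m) :
    exec A id x R ω (t + 1) v =
      (fun i => execSent A id x R ω t (R ⟨v, i⟩)) :: exec A id x R ω t v := rfl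

/-- The dart map of a network. -/
def Network.dartMap (N : Network m) (d : Dart N.deg) : Dart N.deg :=
  ⟨(N.port d.1 d.2).1, N.backPort d.1 d.2⟩

lemma history_eq_exec (A : Algorithm P) (N : Network m) (src : Fin m) (p : P) (ω : Fin m → Tape)
    (t : ℕ) : history A N src p ω t = exec A N.id (input src p) N.dartMap ω t := by
  induction t with
  | zero => rfl
  | succ t ih =>
    funext v
    rw [exec_succ, history, ih]
    rfl

lemma sent_eq_execSent (A : Algorithm P) (N : Network m) (src : Fin m) (p : P)
    (ω : Fin m → Tape) (t : ℕ) (v : Fin m) (i : Fin (N.deg v)) :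
    sent A N src p ω t v i = execSent A N.id (input src p) N.dartMap ω t ⟨v, i⟩ := by
  rw [sent, history_eq_exec]
  rfl

/-- Two dart maps give the same histories as long as nothing is sent at the darts that matter for
their difference. -/
lemma exec_eq_of_silent (A : Algorithm P) (id : Fin m → ℕ) (x : Fin m → Option P)
    (R R' : Dart deg → Dart deg) (ω : Fin m → Tape) (T : ℕ)
    (h : ∀ t < T, ∀ d, R d ≠ R' d →
      execSent A id x R ω t (R d) = none ∧ execSent A id x R ω t (R' d) = none) :
    ∀ t ≤ T, exec A id x R' ω t = exec A id x R ω t := by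
  intro t
  induction t with
  | zero => intro _; rfl
  | succ t ih =>
    intro ht
    have ih := ih (by omega)
    have hs : execSent A id x R' ω t = execSent A id x R ω t := by
      funext d
      rw [execSent, ih, execSent]
    funext v
    rw [exec_succ, exec_succ, ih, hs]
    congr 1
    funext i
    by_cases hd : R ⟨v, i⟩ = R' ⟨v, i⟩
    · rw [hd]
    -- Where the two maps differ, both deliver silence.
    · obtain ⟨h₁, h₂⟩ := h t ht ⟨v, i⟩ hd
      rw [h₁, h₂]

/-- A set of nodes that is closed under the dart map does not notice the inputs outside it. -/
lemma exec_eq_of_closed (A : Algorithm P) (id : Fin m → ℕ) (x x' : Fin m → Option P)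
    (R : Dart deg → Dart deg) (ω : Fin m → Tape) (S : Set (Fin m))
    (hS : ∀ d : Dart deg, d.1 ∈ S → (R d).1 ∈ S) (hx : ∀ v ∈ S, x v = x' v) (t : ℕ) :
    ∀ v ∈ S, exec A id x R ω t v = exec A id x' R ω t v := by
  induction t with
  | zero => intro _ _; rfl
  | succ t ih =>
    intro v hv
    rw [exec_succ, exec_succ, ih v hv]
    congr 1
    funext i
    have := hS ⟨v, i⟩ hv
    rw [execSent, execSent, ih _ this, hx _ this]

/-! ### Measurability -/

lemma measurableSet_send_eq (A : Algorithm P) (n d id : ℕ) (x : Option P) (h : List (Inbox d))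
    (i : Fin d) (o : Option Msg) : MeasurableSet {τ : Tape | A.send n d id x τ h i = o} := by
  cases o with
  | some a => exact A.measurableSet_send n d id x h i a
  | none =>
    have : {τ : Tape | A.send n d id x τ h i = none} =
        (⋃ a : Msg, {τ : Tape | A.send n d id x τ h i = some a})ᶜ := by
      ext τ
      simp [Option.eq_none_iff_forall_ne_some]
    rw [this]
    exact (MeasurableSet.iUnion fun a => A.measurableSet_send n d id x h i a).compl

/-- Histories range over a countable type, so the event is a countable union over the fixed values
of the history; on each piece the condition concerns one tape only. -/
lemma measurableSet_of_history (A : Algorithm P) (id : Fin m → ℕ) (x : Fin m → Option P)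
    (R : Dart deg → Dart deg) (t : ℕ) (v : Fin m)
    (hm : ∀ h, MeasurableSet {ω : Fin m → Tape | exec A id x R ω t v = h})
    (F : Tape → List (Inbox (deg v)) → Prop) (hF : ∀ h, MeasurableSet {τ | F τ h}) :
    MeasurableSet {ω : Fin m → Tape | F (ω v) (exec A id x R ω t v)} := by
  have : {ω : Fin m → Tape | F (ω v) (exec A id x R ω t v)} =
      ⋃ h, {ω : Fin m → Tape | exec A id x R ω t v = h} ∩ (fun ω => ω v) ⁻¹' {τ | F τ h} := by
    ext ω
    simp
  rw [this]
  exact MeasurableSet.iUnion fun h => (hm h).inter (measurable_pi_apply v (hF h))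

lemma measurableSet_exec_eq (A : Algorithm P) (id : Fin m → ℕ) (x : Fin m → Option P)
    (R : Dart deg → Dart deg) (t : ℕ) : ∀ (v : Fin m) (h : List (Inbox (deg v))),
      MeasurableSet {ω : Fin m → Tape | exec A id x R ω t v = h} := by
  induction t with
  | zero => intro v h; simp [exec]
  | succ t ih =>
    intro v h
    cases h with
    | nil => simp [exec]
    | cons b h =>
      have : {ω : Fin m → Tape | exec A id x R ω (t + 1) v = b :: h} =
          (⋂ i, {ω | execSent A id x R ω t (R ⟨v, i⟩) = b i}) ∩
            {ω | exec A id x R ω t v = h} := by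
        ext ω
        simp [exec_succ, funext_iff]
      rw [this]
      refine (MeasurableSet.iInter fun i => ?_).inter (ih v h)
      exact measurableSet_of_history A id x R t _ (ih _)
        (fun τ h => A.send m (deg (R ⟨v, i⟩).1) (id (R ⟨v, i⟩).1) (x (R ⟨v, i⟩).1) τ h
          (R ⟨v, i⟩).2 = b i) fun _ => measurableSet_send_eq A _ _ _ _ _ _ _

lemma measurableSet_execSent_eq (A : Algorithm P) (id : Fin m → ℕ) (x : Fin m → Option P)
    (R : Dart deg → Dart deg) (t : ℕ) (d : Dart deg) (o : Option Msg) :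
    MeasurableSet {ω : Fin m → Tape | execSent A id x R ω t d = o} :=
  measurableSet_of_history A id x R t _ (measurableSet_exec_eq A id x R t _)
    (fun τ h => A.send m (deg d.1) (id d.1) (x d.1) τ h d.2 = o)
    fun _ => measurableSet_send_eq A _ _ _ _ _ _ _

lemma measurable_messages (A : Algorithm P) (N : Network m) (src : Fin m) (p : P) :
    Measurable (messages A N src p) := by
  refine Measurable.tsum fun t => Finset.measurable_sum _ fun v _ =>
    Finset.measurable_sum _ fun i _ => Measurable.ite ?_ measurable_const measurable_const
  have : {ω | (sent A N src p ω t v i).isSome = true} =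
      {ω | execSent A N.id (input src p) N.dartMap ω t ⟨v, i⟩ = none}ᶜ := by
    ext ω
    simp [sent_eq_execSent, Option.isSome_iff_ne_none]
  rw [this]
  exact (measurableSet_execSent_eq A N.id _ _ t _ _).compl

lemma measurableSet_succeeds (A : Algorithm P) (N : Network m) (src : Fin m) (p : P) :
    MeasurableSet {ω | Succeeds A N src p ω} := by
  have : {ω | Succeeds A N src p ω} =
      ⋃ T : ℕ, ⋂ t : ℕ, ⋂ _ : T ≤ t, ⋂ v : Fin m, {ω | outputAt A N src p ω t v = some p} := by
    ext ω
    simp [Succeeds]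
  rw [this]
  refine MeasurableSet.iUnion fun T => MeasurableSet.iInter fun t => MeasurableSet.iInter fun _ =>
    MeasurableSet.iInter fun v => ?_
  simp only [outputAt, history_eq_exec]
  exact measurableSet_of_history A N.id (input src p) N.dartMap t v
    (measurableSet_exec_eq A N.id _ _ t v)
    (fun τ h => A.output m (N.deg v) (N.id v) (input src p v) τ h = some p)
    fun _ => A.measurableSet_output _ _ _ _ _ _

end Exec

instance : IsProbabilityMeasure tapeLaw := by
  unfold tapeLaw
  infer_instance

instance (m : ℕ) : IsProbabilityMeasure (tapesLaw m) := by
  unfold tapesLaw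
  infer_instance

/-! ### Families of networks with hidden edges -/

section Used

variable {P : Type} {m : ℕ} {deg : Fin m → ℕ} {κ L : Type}

open Classical in
/-- The labels `ℓ` such that in the execution along `R` something is sent at a dart labelled
`(i, ℓ)`. -/
def usedLabels [Fintype L] (A : Algorithm P) (id : Fin m → ℕ) (x : Fin m → Option P)
    (lab : Dart deg → Option (κ × L)) (R : Dart deg → Dart deg) (ω : Fin m → Tape) (i : κ) :
    Finset L :=
  {ℓ | ∃ t d, lab d = some (i, ℓ) ∧ execSent A id x R ω t d ≠ none}

lemma mem_usedLabels [Fintype L] (A : Algorithm P) (id : Fin m → ℕ) (x : Fin m → Option P)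
    (lab : Dart deg → Option (κ × L)) (R : Dart deg → Dart deg) (ω : Fin m → Tape) (i : κ) (ℓ : L) :
    ℓ ∈ usedLabels A id x lab R ω i ↔
      ∃ t d, lab d = some (i, ℓ) ∧ execSent A id x R ω t d ≠ none := by
  simp [usedLabels]

/-- A dart map that differs from `R` only at the darts labelled `(i, ℓ)` gives the same histories
until the label `(i, ℓ)` is used. -/
lemma exec_eq_of_unused (A : Algorithm P) (id : Fin m → ℕ) (x : Fin m → Option P)
    (lab : Dart deg → Option (κ × L)) (R R' : Dart deg → Dart deg) (ω : Fin m → Tape) (i : κ) (ℓ : L)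
    (hR : ∀ d, lab (R d) = lab d) (hR' : ∀ d, lab (R' d) = lab d)
    (hne : ∀ d, R d ≠ R' d → lab d = some (i, ℓ)) (T : ℕ)
    (hT : ∀ t < T, ∀ d, lab d = some (i, ℓ) → execSent A id x R ω t d = none) :
    ∀ t ≤ T, exec A id x R' ω t = exec A id x R ω t := by
  refine exec_eq_of_silent A id x R R' ω T fun t ht d hd => ⟨?_, ?_⟩
  · exact hT t ht _ ((hR d).trans (hne d hd))
  · exact hT t ht _ ((hR' d).trans (hne d hd))

/-- For any two elements of `U`, at least one comes no later than the other in the order given by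
`T`, so at least half of the ordered pairs are counted by the sets `F ℓ`. -/
lemma card_sq_le_of_total {L : Type} [Fintype L] (U : Finset L) (F : L → Finset L) (T : L → ℕ)
    (h : ∀ ℓ ∈ U, ∀ ℓ' ∈ U, T ℓ' ≤ T ℓ → ℓ' ∈ F ℓ) :
    U.card ^ 2 ≤ 2 * ∑ ℓ, (F ℓ).card := by
  classical
  have h₁ : ∑ ℓ ∈ U, ∑ ℓ' ∈ U, (if T ℓ' ≤ T ℓ then 1 else 0) ≤ ∑ ℓ, (F ℓ).card := by
    refine (Finset.sum_le_sum fun ℓ hℓ => ?_).trans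
      (Finset.sum_le_sum_of_subset (Finset.subset_univ U))
    rw [← Finset.card_filter]
    refine Finset.card_le_card fun ℓ' hℓ' => ?_
    rw [Finset.mem_filter] at hℓ'
    exact h ℓ hℓ ℓ' hℓ'.1 hℓ'.2
  have h₂ : ∑ ℓ ∈ U, ∑ ℓ' ∈ U, (if T ℓ ≤ T ℓ' then 1 else 0) =
      ∑ ℓ ∈ U, ∑ ℓ' ∈ U, (if T ℓ' ≤ T ℓ then 1 else 0) := Finset.sum_comm
  have h₃ : U.card ^ 2 ≤ ∑ ℓ ∈ U, ∑ ℓ' ∈ U, (if T ℓ' ≤ T ℓ then 1 else 0) +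
      ∑ ℓ ∈ U, ∑ ℓ' ∈ U, (if T ℓ ≤ T ℓ' then 1 else 0) := by
    rw [← Finset.sum_add_distrib]
    simp_rw [← Finset.sum_add_distrib]
    calc U.card ^ 2 = ∑ ℓ ∈ U, ∑ ℓ' ∈ U, 1 := by simp [sq]
      _ ≤ _ := Finset.sum_le_sum fun ℓ _ => Finset.sum_le_sum fun ℓ' _ => by
        rcases le_total (T ℓ) (T ℓ') with h | h <;> simp [h]
  omega

/-- If the dart maps `R' ℓ` arise from `R` by a change at the label `(i, ℓ)` only, then in the
executions along the maps `R' ℓ` many labels are used on average. -/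
lemma card_usedLabels_sq_le [Fintype L] (A : Algorithm P) (id : Fin m → ℕ) (x : Fin m → Option P)
    (lab : Dart deg → Option (κ × L)) (R : Dart deg → Dart deg) (R' : L → Dart deg → Dart deg)
    (ω : Fin m → Tape) (i : κ) (hR : ∀ d, lab (R d) = lab d) (hR' : ∀ ℓ d, lab (R' ℓ d) = lab d)
    (hne : ∀ ℓ d, R d ≠ R' ℓ d → lab d = some (i, ℓ)) :
    (usedLabels A id x lab R ω i).card ^ 2 ≤
      2 * ∑ ℓ, (usedLabels A id x lab (R' ℓ) ω i).card := by
  classical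
  -- `T ℓ` is the first round in which `ℓ` is used along `R`, with the junk value `0` for unused
  -- labels.
  have key : ∀ ℓ, ∃ T, ℓ ∈ usedLabels A id x lab R ω i →
      (∃ d, lab d = some (i, ℓ) ∧ execSent A id x R ω T d ≠ none) ∧
      ∀ t < T, ∀ d, lab d = some (i, ℓ) → execSent A id x R ω t d = none := by
    intro ℓ
    by_cases hℓ : ℓ ∈ usedLabels A id x lab R ω i
    · have hex := (mem_usedLabels ..).1 hℓ
      refine ⟨Nat.find hex, fun _ => ⟨Nat.find_spec hex, fun t ht d hd => ?_⟩⟩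
      by_contra hs
      exact Nat.find_min hex ht ⟨d, hd, hs⟩
    · exact ⟨0, fun h => absurd h hℓ⟩
  choose T hT using key
  refine card_sq_le_of_total _ _ T fun ℓ hℓ ℓ' hℓ' hle => ?_
  obtain ⟨d, hd, hs⟩ := (hT ℓ' hℓ').1
  refine (mem_usedLabels ..).2 ⟨T ℓ', d, hd, ?_⟩
  -- What is sent in round `T ℓ` depends only on earlier rounds, so the executions still send the
  -- same in that round; hence labels first used in the same round count as well.
  rwa [execSent, exec_eq_of_unused A id x lab R (R' ℓ) ω i ℓ hR (hR' ℓ) (hne ℓ) (T ℓ)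
    (hT ℓ hℓ).2 _ hle]

end Used

/-- A family of networks on `m` nodes with the same degrees and identifiers, indexed by the choice
of a hidden label `e i : L` for each `i : κ`.  The dart maps also make sense if some of the labels
are not chosen; if the label at `i` is not chosen, then the part `part i` is cut off from the
rest. -/
structure HiddenFamily (m : ℕ) (κ L : Type) [DecidableEq κ] where
  deg : Fin m → ℕ
  id : Fin m → ℕ
  id_injective : Function.Injective id
  graph : (κ → L) → SimpleGraph (Fin m)
  connected : ∀ e, (graph e).Connected
  port : ∀ e v, Fin (deg v) ≃ (graph e).neighborSet v
  lab : Dart deg → Option (κ × L)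
  dartMap : (κ → Option L) → Dart deg → Dart deg
  lab_dartMap : ∀ e d, lab (dartMap e d) = lab d
  lab_of_dartMap_ne : ∀ e i ℓ d, dartMap (Function.update e i none) d ≠
    dartMap (Function.update e i (some ℓ)) d → lab d = some (i, ℓ)
  dartMap_eq : ∀ e, Network.dartMap ⟨graph e, connected e, deg, port e, id, id_injective⟩ =
    dartMap fun i => some (e i)
  src : Fin m
  part : κ → Set (Fin m)
  part_nonempty : ∀ i, (part i).Nonempty
  src_notMem_part : ∀ i, src ∉ part i
  part_closed : ∀ e i d, e i = none → d.1 ∈ part i → (dartMap e d).1 ∈ part i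

namespace HiddenFamily

variable {P : Type} {m : ℕ} {κ L : Type} [DecidableEq κ] (H : HiddenFamily m κ L)

/-- The network with hidden labels `e`. -/
abbrev net (e : κ → L) : Network m :=
  ⟨H.graph e, H.connected e, H.deg, H.port e, H.id, H.id_injective⟩

/-- The labels at `i` used in the execution on the network with hidden labels `e`. -/
def used [Fintype L] (A : Algorithm P) (p : P) (ω : Fin m → Tape) (e : κ → L) (i : κ) : Finset L :=
  usedLabels A H.id (input H.src p) H.lab (H.dartMap fun j => some (e j)) ω i

lemma sent_net (A : Algorithm P) (p : P) (ω : Fin m → Tape) (e : κ → L) (t : ℕ) (d : Dart H.deg) :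
    sent A (H.net e) H.src p ω t d.1 d.2 =
      execSent A H.id (input H.src p) (H.dartMap fun j => some (e j)) ω t d := by
  rw [sent_eq_execSent, H.dartMap_eq]

lemma outputAt_net (A : Algorithm P) (p : P) (ω : Fin m → Tape) (e : κ → L) (t : ℕ) (v : Fin m) :
    outputAt A (H.net e) H.src p ω t v = A.output m (H.deg v) (H.id v) (input H.src p v) (ω v)
      (exec A H.id (input H.src p) (H.dartMap fun j => some (e j)) ω t v) := by
  rw [outputAt, history_eq_exec, H.dartMap_eq]

lemma some_update (e : κ → L) (i : κ) (ℓ : L) :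
    (fun j => some (Function.update e i ℓ j)) =
      Function.update (fun j => some (e j)) i (some ℓ) := by
  funext j
  by_cases h : j = i
  · subst h; simp
  · simp [h]

/-- If a label is used neither with source message `p` nor with source message `q` in the execution
in which the part `i` is cut off, then the broadcast cannot succeed for both messages on the network
in which this label is hidden at `i`. -/
lemma mem_or_mem_usedLabels [Fintype L] (A : Algorithm P) {p q : P} (hpq : p ≠ q)
    (ω : Fin m → Tape) (e : κ → L) (i : κ) (ℓ : L)
    (hp : Succeeds A (H.net (Function.update e i ℓ)) H.src p ω)
    (hq : Succeeds A (H.net (Function.update e i ℓ)) H.src q ω) :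
    let R := H.dartMap (Function.update (fun j => some (e j)) i none)
    ℓ ∈ usedLabels A H.id (input H.src p) H.lab R ω i ∨
      ℓ ∈ usedLabels A H.id (input H.src q) H.lab R ω i := by
  intro R
  by_contra! hno
  have hexec : ∀ r, ℓ ∉ usedLabels A H.id (input H.src r) H.lab R ω i → ∀ t,
      exec A H.id (input H.src r) (H.dartMap fun j => some (Function.update e i ℓ j)) ω t =
        exec A H.id (input H.src r) R ω t := by
    intro r hr t
    rw [some_update]
    refine exec_eq_of_unused A H.id _ H.lab R _ ω i ℓ (H.lab_dartMap _) (H.lab_dartMap _)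
      (fun d hd => H.lab_of_dartMap_ne _ i ℓ d hd) t (fun t' _ d hd => ?_) t le_rfl
    by_contra hs
    exact hr ((mem_usedLabels ..).2 ⟨t', d, hd, hs⟩)
  obtain ⟨T₁, hT₁⟩ := hp
  obtain ⟨T₂, hT₂⟩ := hq
  obtain ⟨v, hv⟩ := H.part_nonempty i
  have hin : ∀ w ∈ H.part i, input H.src p w = input H.src q w := by
    intro w hw
    have : w ≠ H.src := fun h => H.src_notMem_part i (h ▸ hw)
    simp [input, this]
  -- In a round where both broadcasts have settled, a node of the cut-off part has the same history
  -- for `p` and `q`, hence the same output.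
  have h₁ := hT₁ (max T₁ T₂) (le_max_left _ _) v
  have h₂ := hT₂ (max T₁ T₂) (le_max_right _ _) v
  rw [outputAt_net, hexec p hno.1, hin v hv, exec_eq_of_closed A H.id _ _ R ω (H.part i)
    (fun d hd => H.part_closed _ i d (by simp) hd) hin _ v hv] at h₁
  rw [outputAt_net, hexec q hno.2, h₁] at h₂
  exact hpq (Option.some.inj h₂)

open Classical in
/-- The averaged lower bound on the number of used labels, for one part and one choice of the
random tapes. -/
lemma sum_card_used_ge [Fintype L] (A : Algorithm P) {p q : P} (hpq : p ≠ q)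
    (ω : Fin m → Tape) (e : κ → L) (i : κ) :
    4 * Fintype.card L * (∑ ℓ, if Succeeds A (H.net (Function.update e i ℓ)) H.src p ω ∧
        Succeeds A (H.net (Function.update e i ℓ)) H.src q ω then 1 else 0) ≤
      16 * ∑ ℓ, ((H.used A p ω (Function.update e i ℓ) i).card +
        (H.used A q ω (Function.update e i ℓ) i).card) + Fintype.card L ^ 2 := by
  set R := H.dartMap (Function.update (fun j => some (e j)) i none) with hRdef
  have hsq : ∀ r, (usedLabels A H.id (input H.src r) H.lab R ω i).card ^ 2 ≤
      2 * ∑ ℓ, (H.used A r ω (Function.update e i ℓ) i).card := by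
    intro r
    refine card_usedLabels_sq_le A H.id (input H.src r) H.lab R
      (fun ℓ => H.dartMap fun j => some (Function.update e i ℓ j)) ω i (H.lab_dartMap _)
      (fun ℓ => H.lab_dartMap _) fun ℓ d hd => ?_
    rw [some_update] at hd
    exact H.lab_of_dartMap_ne _ i ℓ d hd
  have hp := hsq p
  have hq := hsq q
  have hg : (∑ ℓ, if Succeeds A (H.net (Function.update e i ℓ)) H.src p ω ∧
        Succeeds A (H.net (Function.update e i ℓ)) H.src q ω then 1 else 0) ≤
      (usedLabels A H.id (input H.src p) H.lab R ω i).card +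
        (usedLabels A H.id (input H.src q) H.lab R ω i).card := by
    rw [← Finset.card_filter]
    refine le_trans (Finset.card_le_card fun ℓ hℓ => ?_) (Finset.card_union_le _ _)
    rw [Finset.mem_filter] at hℓ
    exact Finset.mem_union.2 (H.mem_or_mem_usedLabels A hpq ω e i ℓ hℓ.2.1 hℓ.2.2)
  rw [Finset.sum_add_distrib]
  generalize (∑ ℓ, if Succeeds A (H.net (Function.update e i ℓ)) H.src p ω ∧
        Succeeds A (H.net (Function.update e i ℓ)) H.src q ω then 1 else 0) = g at *
  generalize (usedLabels A H.id (input H.src p) H.lab R ω i).card = a at *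
  generalize (usedLabels A H.id (input H.src q) H.lab R ω i).card = b at *
  generalize ∑ ℓ, (H.used A p ω (Function.update e i ℓ) i).card = X at *
  generalize ∑ ℓ, (H.used A q ω (Function.update e i ℓ) i).card = Y at *
  generalize Fintype.card L = M at *
  zify at *
  -- `4 M g ≤ 4 g² + M²` and `g² ≤ (a + b)² ≤ 2 (a² + b²) ≤ 4 (X + Y)`. The first inequality makes
  -- the bound linear in `g`, ready for averaging.
  nlinarith [sq_nonneg (2 * (g : ℤ) - M), sq_nonneg ((a : ℤ) - b),
    mul_self_le_mul_self (by positivity : (0 : ℤ) ≤ g) hg]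

/-- The number of messages is at least the number of used labels. -/
lemma sum_card_used_le_messages [Fintype κ] [Fintype L] (A : Algorithm P) (p : P)
    (ω : Fin m → Tape) (e : κ → L) :
    ((∑ i, (H.used A p ω e i).card : ℕ) : ENNReal) ≤ messages A (H.net e) H.src p ω := by
  classical
  set R := H.dartMap fun j => some (e j) with hR
  have hmsg : messages A (H.net e) H.src p ω = ∑' td : ℕ × Dart H.deg,
      if (execSent A H.id (input H.src p) R ω td.1 td.2).isSome then 1 else 0 := by
    rw [ENNReal.tsum_prod (f := fun t d =>
      if (execSent A H.id (input H.src p) R ω t d).isSome then (1 : ENNReal) else 0)]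
    refine tsum_congr fun t => ?_
    rw [tsum_fintype, Fintype.sum_sigma]
    refine Finset.sum_congr rfl fun v _ => Finset.sum_congr rfl fun i _ => ?_
    rw [H.sent_net A p ω e t ⟨v, i⟩]
  set W := Finset.univ.sigma fun i => H.used A p ω e i with hW
  have key : ∀ a ∈ W, ∃ td : ℕ × Dart H.deg, H.lab td.2 = some (a.1, a.2) ∧
      execSent A H.id (input H.src p) R ω td.1 td.2 ≠ none := by
    intro a ha
    obtain ⟨t, d, h⟩ := (mem_usedLabels ..).1 (Finset.mem_sigma.1 ha).2
    exact ⟨(t, d), h⟩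
  choose f hf using key
  -- A dart has at most one label, so the events chosen for distinct labels are distinct.
  have hinj : Function.Injective fun a : W => f a.1 a.2 := by
    rintro ⟨⟨i, ℓ⟩, ha⟩ ⟨⟨j, ℓ'⟩, hb⟩ hab
    have h := (hf _ ha).1
    simp only at hab
    rw [hab, (hf _ hb).1] at h
    simp only [Option.some.injEq, Prod.mk.injEq] at h
    simp [h.1, h.2]
  rw [← Finset.card_sigma, hmsg, ← Finset.card_attach, ← Finset.card_image_of_injective _ hinj,
    Finset.card_eq_sum_ones, Nat.cast_sum]
  refine le_trans (Finset.sum_le_sum fun td htd => ?_) (ENNReal.sum_le_tsum _)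
  obtain ⟨a, -, rfl⟩ := Finset.mem_image.1 htd
  rw [if_pos (Option.isSome_iff_ne_none.2 (hf _ a.2).2), Nat.cast_one]

/-- Exchanging `ℓ` with `e i` is an involution of the pairs `(e, ℓ)`: resampling one coordinate of a
uniform `e` leaves it uniform. -/
lemma sum_sum_update [Fintype κ] [Fintype L] {β : Type*} [AddCommMonoid β] (i : κ)
    (f : (κ → L) → β) :
    ∑ e : κ → L, ∑ ℓ, f (Function.update e i ℓ) = Fintype.card L • ∑ e, f e := by
  rw [← Fintype.sum_prod_type' (f := fun e ℓ => f (Function.update e i ℓ))]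
  let σ : (κ → L) × L → (κ → L) × L := fun a => (Function.update a.1 i a.2, a.1 i)
  have hσ : Function.Involutive σ := by
    rintro ⟨e, ℓ⟩
    simp [σ]
  calc ∑ a : (κ → L) × L, f (Function.update a.1 i a.2) = ∑ a : (κ → L) × L, f a.1 :=
        Fintype.sum_equiv hσ.toPerm _ _ fun a => rfl
    _ = ∑ e : κ → L, ∑ _ : L, f e := Fintype.sum_prod_type' (f := fun e (_ : L) => f e)
    _ = _ := by simp [Finset.smul_sum]

open Classical in
/-- The averaged lower bound on the number of messages, for one choice of the random tapes. -/
lemma sum_messages_ge [Fintype κ] [Fintype L] [Nonempty L] (A : Algorithm P) {p q : P}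
    (hpq : p ≠ q) (ω : Fin m → Tape) :
    ((4 * Fintype.card κ * Fintype.card L : ℕ) : ENNReal) *
        (∑ e : κ → L, if Succeeds A (H.net e) H.src p ω ∧ Succeeds A (H.net e) H.src q ω
          then 1 else 0) ≤
      16 * ∑ e, (messages A (H.net e) H.src p ω + messages A (H.net e) H.src q ω) +
        ((Fintype.card κ * Fintype.card L * Fintype.card (κ → L) : ℕ) : ENNReal) := by
  set M := Fintype.card L with hM
  have hMpos : 0 < M := Fintype.card_pos
  have hi : ∀ i : κ, 4 * M * (∑ e : κ → L, if Succeeds A (H.net e) H.src p ω ∧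
      Succeeds A (H.net e) H.src q ω then 1 else 0) ≤
      16 * ∑ e, ((H.used A p ω e i).card + (H.used A q ω e i).card) +
        M * Fintype.card (κ → L) := by
    intro i
    have h := Finset.sum_le_sum fun (e : κ → L) (_ : e ∈ Finset.univ) =>
      H.sum_card_used_ge A hpq ω e i
    rw [← Finset.mul_sum, Finset.sum_add_distrib, ← Finset.mul_sum,
      sum_sum_update i (fun e => if Succeeds A (H.net e) H.src p ω ∧
        Succeeds A (H.net e) H.src q ω then 1 else 0),
      sum_sum_update i (fun e => (H.used A p ω e i).card + (H.used A q ω e i).card),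
      ← hM, Finset.sum_const, Finset.card_univ, smul_eq_mul, smul_eq_mul, smul_eq_mul] at h
    refine Nat.le_of_mul_le_mul_left (le_trans (le_of_eq ?_) (h.trans (le_of_eq ?_))) hMpos <;> ring
  have hsum := Finset.sum_le_sum fun (i : κ) (_ : i ∈ Finset.univ) => hi i
  rw [Finset.sum_const, Finset.sum_add_distrib, ← Finset.mul_sum, Finset.sum_const,
    Finset.card_univ, Finset.sum_comm] at hsum
  have hmsg : ((∑ e : κ → L, ∑ i, ((H.used A p ω e i).card + (H.used A q ω e i).card) : ℕ) :
      ENNReal) ≤ ∑ e, (messages A (H.net e) H.src p ω + messages A (H.net e) H.src q ω) := by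
    rw [Nat.cast_sum]
    refine Finset.sum_le_sum fun e _ => ?_
    rw [Finset.sum_add_distrib, Nat.cast_add]
    exact add_le_add (H.sum_card_used_le_messages A p ω e) (H.sum_card_used_le_messages A q ω e)
  have hcast : ((∑ e : κ → L, if Succeeds A (H.net e) H.src p ω ∧
      Succeeds A (H.net e) H.src q ω then 1 else 0 : ℕ) : ENNReal) =
      ∑ e : κ → L, if Succeeds A (H.net e) H.src p ω ∧
      Succeeds A (H.net e) H.src q ω then 1 else 0 := by
    push_cast
    rfl
  rw [← hcast]
  refine le_trans ?_ (add_le_add (mul_le_mul_right hmsg 16) le_rfl)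
  rw [← Nat.cast_mul, ← Nat.cast_ofNat (n := 16), ← Nat.cast_mul, ← Nat.cast_add, Nat.cast_le]
  refine le_trans (le_of_eq ?_) (hsum.trans (le_of_eq ?_)) <;> simp only [smul_eq_mul] <;> ring

/-- Inclusion-exclusion: `3/4 + 3/4 - 1 = 1/2`. -/
lemma half_le_measure_inter {Ω : Type*} [MeasurableSpace Ω] (μ : Measure Ω)
    [IsProbabilityMeasure μ] {s t : Set Ω} (ht : MeasurableSet t)
    (h₁ : 3 / 4 ≤ μ.real s) (h₂ : 3 / 4 ≤ μ.real t) : ENNReal.ofReal (1 / 2) ≤ μ (s ∩ t) := by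
  have h := measureReal_union_add_inter (μ := μ) (s := s) ht
  have h' : μ.real (s ∪ t) ≤ 1 := measureReal_le_one
  rw [← ofReal_measureReal]
  exact ENNReal.ofReal_le_ofReal (by linarith)

/-- If the broadcast succeeds with probability at least `3 / 4` on all networks of the family for
each of two source messages, then on some network of the family, the expected number of messages is
large for one of the two. -/
theorem exists_expectedMessages_ge [Fintype κ] [Fintype L] [Nonempty L] (A : Algorithm P) {p q : P}
    (hpq : p ≠ q) (hs : ∀ e r, 3 / 4 ≤ successProb A (H.net e) H.src r) :
    ∃ e r, ENNReal.ofReal (Fintype.card κ * Fintype.card L / 32) ≤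
      expectedMessages A (H.net e) H.src r := by
  classical
  by_contra! hlt
  set a : ENNReal := ENNReal.ofReal (Fintype.card κ * Fintype.card L / 32) with ha
  set C := Fintype.card (κ → L) with hC
  have hint := lintegral_mono (μ := tapesLaw m) fun ω => H.sum_messages_ge A hpq ω
  have hms : ∀ e : κ → L, MeasurableSet {ω | Succeeds A (H.net e) H.src p ω ∧
      Succeeds A (H.net e) H.src q ω} := fun e =>
    (measurableSet_succeeds A _ _ p).inter (measurableSet_succeeds A _ _ q)
  have hmi : ∀ e : κ → L, Measurable fun ω => if Succeeds A (H.net e) H.src p ω ∧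
      Succeeds A (H.net e) H.src q ω then (1 : ENNReal) else 0 := fun e =>
    Measurable.ite (hms e) measurable_const measurable_const
  have hmm : ∀ e r, Measurable (messages A (H.net e) H.src r) := fun e r =>
    measurable_messages A _ _ r
  have hma : ∀ e, Measurable fun ω =>
      messages A (H.net e) H.src p ω + messages A (H.net e) H.src q ω := fun e =>
    (hmm e p).add (hmm e q)
  rw [lintegral_const_mul _ (Finset.measurable_sum _ fun e _ => hmi e),
    lintegral_finsetSum _ fun e _ => hmi e, lintegral_add_right _ measurable_const,
    lintegral_const_mul _ (Finset.measurable_sum _ fun e _ => hma e),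
    lintegral_finsetSum _ fun e _ => hma e, lintegral_const,
    measure_univ, mul_one] at hint
  have hlow : (C : ENNReal) * ENNReal.ofReal (1 / 2) ≤ ∑ e : κ → L, ∫⁻ ω,
      (if Succeeds A (H.net e) H.src p ω ∧ Succeeds A (H.net e) H.src q ω
        then (1 : ENNReal) else 0) ∂(tapesLaw m) := by
    rw [hC, ← Finset.card_univ, ← nsmul_eq_mul, ← Finset.sum_const]
    refine Finset.sum_le_sum fun e _ => ?_
    have : (fun ω => if Succeeds A (H.net e) H.src p ω ∧ Succeeds A (H.net e) H.src q ω
        then (1 : ENNReal) else 0) = {ω | Succeeds A (H.net e) H.src p ω ∧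
          Succeeds A (H.net e) H.src q ω}.indicator 1 := by
      funext ω
      simp [Set.indicator_apply]
    rw [this, lintegral_indicator_one (hms e)]
    exact half_le_measure_inter _ (measurableSet_succeeds A _ _ q) (hs e p) (hs e q)
  have hup : ∑ e : κ → L, ∫⁻ ω, (messages A (H.net e) H.src p ω + messages A (H.net e) H.src q ω)
      ∂(tapesLaw m) < ∑ e : κ → L, (a + a) := by
    refine ENNReal.sum_lt_sum_of_nonempty Finset.univ_nonempty fun e _ => ?_
    rw [lintegral_add_left (hmm e p)]
    exact ENNReal.add_lt_add (hlt e p) (hlt e q)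
  rw [Finset.sum_const, Finset.card_univ, nsmul_eq_mul, ← hC] at hup
  have h₁ := (mul_le_mul_right hlow _).trans hint
  have h₂ : 16 * ∑ e : κ → L, ∫⁻ ω, (messages A (H.net e) H.src p ω +
      messages A (H.net e) H.src q ω) ∂(tapesLaw m) < 16 * (C * (a + a)) :=
    (ENNReal.mul_lt_mul_iff_right (by norm_num) (by norm_num)).2 hup
  have h₃ := h₁.trans_lt (ENNReal.add_lt_add_right (ENNReal.natCast_ne_top _) h₂)
  rw [ha, ← ENNReal.ofReal_add (by positivity) (by positivity), ← ENNReal.ofReal_natCast,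
    ← ENNReal.ofReal_natCast, ← ENNReal.ofReal_natCast, ← ENNReal.ofReal_ofNat,
    ← ENNReal.ofReal_mul (by positivity), ← ENNReal.ofReal_mul (by positivity),
    ← ENNReal.ofReal_mul (by positivity), ← ENNReal.ofReal_mul (by positivity),
    ← ENNReal.ofReal_add (by positivity) (by positivity), ENNReal.ofReal_lt_ofReal_iff'] at h₃
  -- The constant `32` makes both sides equal: with `M = card L`, each is `2 · card κ · M · C`,
  -- since `16 · C · 2 · (card κ · M / 32)` is `card κ · M · C`.
  refine absurd h₃.1 (not_lt.2 (le_of_eq ?_))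
  push_cast
  ring

end HiddenFamily

/-! ### Switching edges -/

/-- A graph with an involution of its vertices and a labelling of pairs of vertices.  Switching a
label replaces the edges `vw` with this label by the edges between `v` and the image of `w` under the
involution.  Without switches, the parts are unions of components. -/
structure Switch (W κ L : Type) where
  base : SimpleGraph W
  flip : W → W
  lab : W → W → Option (κ × L)
  flip_flip : ∀ v, flip (flip v) = v
  lab_symm : ∀ v w, lab v w = lab w v
  lab_flip : ∀ v w, lab v (flip w) = lab v w
  lab_self : ∀ v, lab v v = none
  adj_flip : ∀ v w, lab v w ≠ none → base.Adj v w → base.Adj (flip v) (flip w)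
  hub : W
  part : κ → Set W
  part_nonempty : ∀ i, (part i).Nonempty
  hub_notMem_part : ∀ i, hub ∉ part i
  part_closed : ∀ i v w, v ∈ part i → base.Adj v w → w ∈ part i ∧ ∃ ℓ, lab v w = some (i, ℓ)

namespace Switch

variable {W κ L : Type} (S : Switch W κ L)

/-- Whether a label is switched. -/
def Marked (e : κ → Option L) (o : Option (κ × L)) : Prop :=
  ∃ i ℓ, o = some (i, ℓ) ∧ e i = some ℓ

open Classical in
/-- The image of `w` under the involution if the pair `vw` has a switched label, and `w` otherwise. -/
def twist (e : κ → Option L) (v w : W) : W :=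
  if Marked e (S.lab v w) then S.flip w else w

lemma lab_twist (e : κ → Option L) (v w : W) : S.lab v (S.twist e v w) = S.lab v w := by
  unfold twist
  split_ifs
  · exact S.lab_flip v w
  · rfl

lemma twist_of_lab_eq (e : κ → Option L) {v w v' : W} (h : S.lab v' w = S.lab v w) :
    S.twist e v' w = S.twist e v w := by
  unfold twist
  rw [h]

lemma twist_congr {e e' : κ → Option L} {v w : W}
    (h : Marked e (S.lab v w) ↔ Marked e' (S.lab v w)) : S.twist e v w = S.twist e' v w := by
  by_cases h' : Marked e' (S.lab v w)
  · simp [twist, h.2 h', h']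
  · simp [twist, mt h.1 h', h']

lemma twist_twist (e : κ → Option L) (v w : W) : S.twist e v (S.twist e v w) = w := by
  by_cases h : Marked e (S.lab v w)
  · simp [twist, h, S.lab_flip, S.flip_flip]
  · simp [twist, h]

lemma lab_twist_left (e : κ → Option L) (v w : W) : S.lab (S.twist e v w) v = S.lab w v := by
  rw [S.lab_symm, lab_twist, S.lab_symm]

lemma lab_twist_twist (e : κ → Option L) (v w : W) :
    S.lab (S.twist e v w) (S.twist e w v) = S.lab v w := by
  rw [← S.twist_of_lab_eq e (S.lab_twist_left e v w), lab_twist, lab_twist_left, S.lab_symm]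

/-- If `w` is a base neighbour of `v`, the switched graph joins `v` to `twist v w`, and the way back
starts at the port of the base neighbour `twist w v`. This lemma says that this port exists. -/
lemma adj_twist_twist (e : κ → Option L) {v w : W} (h : S.base.Adj v w) :
    S.base.Adj (S.twist e v w) (S.twist e w v) := by
  by_cases hm : Marked e (S.lab v w)
  · have hm' : Marked e (S.lab w v) := S.lab_symm v w ▸ hm
    rw [twist, twist, if_pos hm, if_pos hm']
    obtain ⟨i, ℓ, ho, -⟩ := hm'
    exact S.adj_flip w v (by simp [ho]) h.symm
  · have hm' : ¬Marked e (S.lab w v) := S.lab_symm v w ▸ hm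
    rw [twist, twist, if_neg hm, if_neg hm']
    exact h.symm

/-- The graph with switched edges. -/
def graph (e : κ → Option L) : SimpleGraph W where
  Adj v w := S.base.Adj v (S.twist e v w)
  symm := ⟨fun v w h => by
    have h' := (S.adj_twist_twist e h).symm
    rw [twist_twist, S.twist_of_lab_eq e (S.lab_twist_left e v w)] at h'
    exact h'.symm⟩
  loopless := ⟨fun v h => by
    simp [twist, S.lab_self, Marked] at h⟩

lemma graph_adj (e : κ → Option L) (v w : W) :
    (S.graph e).Adj v w ↔ S.base.Adj v (S.twist e v w) := Iff.rfl

/-- Twisting identifies the neighbours in the base graph with those in the switched graph. -/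
def neighborEquiv (e : κ → Option L) (v : W) : S.base.neighborSet v ≃ (S.graph e).neighborSet v where
  toFun w := ⟨S.twist e v w, by
    rw [SimpleGraph.mem_neighborSet, graph_adj, twist_twist]; exact w.2⟩
  invFun w := ⟨S.twist e v w, w.2⟩
  left_inv w := Subtype.ext (S.twist_twist e v w)
  right_inv w := Subtype.ext (S.twist_twist e v w)

/-- Transport along a bijection of the vertices. -/
def comap {W' : Type} (ψ : W' ≃ W) : Switch W' κ L where
  base := S.base.comap ψ
  flip v := ψ.symm (S.flip (ψ v))
  lab v w := S.lab (ψ v) (ψ w)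
  flip_flip v := by simp [S.flip_flip]
  lab_symm v w := S.lab_symm _ _
  lab_flip v w := by simp [S.lab_flip]
  lab_self v := S.lab_self _
  adj_flip v w h := by simpa using S.adj_flip _ _ h
  hub := ψ.symm S.hub
  part i := ψ ⁻¹' S.part i
  part_nonempty i := (S.part_nonempty i).preimage ψ.surjective
  hub_notMem_part i := by simpa using S.hub_notMem_part i
  part_closed i v w hv h := S.part_closed i _ _ hv h

lemma comap_twist {W' : Type} (ψ : W' ≃ W) (e : κ → Option L) (v w : W') :
    ψ ((S.comap ψ).twist e v w) = S.twist e (ψ v) (ψ w) := by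
  by_cases h : Marked e (S.lab (ψ v) (ψ w))
  · simp [twist, comap, h]
  · simp [twist, comap, h]

/-- The switched graph of the transported structure is isomorphic to the original one. -/
def comapIso {W' : Type} (ψ : W' ≃ W) (e : κ → Option L) :
    (S.comap ψ).graph e ≃g S.graph e where
  toEquiv := ψ
  map_rel_iff' {v w} := by
    rw [graph_adj, graph_adj, ← comap_twist]
    rfl

section Dart

variable {m : ℕ} (S : Switch (Fin m) κ L)

/-- The degrees in the base graph. -/
def deg (v : Fin m) : ℕ := Nat.card (S.base.neighborSet v)

/-- A numbering of the neighbours in the base graph. -/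
def basePort (v : Fin m) : Fin (S.deg v) ≃ S.base.neighborSet v :=
  (Finite.equivFin (S.base.neighborSet v)).symm

lemma adj_basePort (d : Dart S.deg) : S.base.Adj d.1 (S.basePort d.1 d.2) := (S.basePort d.1 d.2).2

/-- The dart that leads from `v` to its neighbour `w` in the base graph. -/
def dart (v w : Fin m) (h : S.base.Adj v w) : Dart S.deg := ⟨v, (S.basePort v).symm ⟨w, h⟩⟩

lemma dart_congr {v w v' w' : Fin m} (hv : v = v') (hw : w = w') (h : S.base.Adj v w)
    (h' : S.base.Adj v' w') : S.dart v w h = S.dart v' w' h' := by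
  subst hv hw
  rfl

/-- The dart map of the graph with switched edges. -/
def dartMap (e : κ → Option L) (d : Dart S.deg) : Dart S.deg :=
  S.dart (S.twist e d.1 (S.basePort d.1 d.2)) (S.twist e (S.basePort d.1 d.2) d.1)
    (S.adj_twist_twist e (S.adj_basePort d))

/-- The label of a dart. -/
def dartLab (d : Dart S.deg) : Option (κ × L) := S.lab d.1 (S.basePort d.1 d.2)

lemma dartLab_dart (v w : Fin m) (h : S.base.Adj v w) : S.dartLab (S.dart v w h) = S.lab v w := by
  rw [dartLab, dart, Equiv.apply_symm_apply]

lemma marked_update_iff [DecidableEq κ] (e : κ → Option L) (i : κ) (ℓ : L) (o : Option (κ × L))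
    (ho : o ≠ some (i, ℓ)) : Marked (Function.update e i none) o ↔
      Marked (Function.update e i (some ℓ)) o := by
  unfold Marked
  refine exists_congr fun j => exists_congr fun ℓ' => and_congr_right fun hj => ?_
  by_cases hji : j = i
  · subst hji
    simp only [Function.update_self, reduceCtorEq, Option.some.injEq, false_iff]
    rintro rfl
    exact ho hj
  · simp [hji]

/-- The family of networks obtained by switching one label for each `i : κ`. -/
def hiddenFamily [DecidableEq κ] (id : Fin m → ℕ) (id_injective : Function.Injective id)
    (connected : ∀ e : κ → L, (S.graph fun i => some (e i)).Connected) : HiddenFamily m κ L where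
  deg := S.deg
  id := id
  id_injective := id_injective
  graph e := S.graph fun i => some (e i)
  connected := connected
  -- Ports are numbered in the base graph and carried over by the twist, so that the numbering does
  -- not betray the switched labels.
  port e v := (S.basePort v).trans (S.neighborEquiv _ v)
  lab := S.dartLab
  dartMap := S.dartMap
  lab_dartMap e d := by
    rw [dartMap, dartLab_dart, lab_twist_twist, dartLab]
  lab_of_dartMap_ne e i ℓ d h := by
    by_contra ho
    refine h (S.dart_congr ?_ ?_ _ _)
    · exact S.twist_congr (marked_update_iff e i ℓ _ ho)
    · rw [dartLab, S.lab_symm] at ho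
      exact S.twist_congr (marked_update_iff e i ℓ _ ho)
  dartMap_eq e := by
    funext d
    refine S.dart_congr rfl ?_ _ _
    exact S.twist_of_lab_eq _ (S.lab_twist_left _ _ _)
  src := S.hub
  part := S.part
  part_nonempty := S.part_nonempty
  src_notMem_part := S.hub_notMem_part
  part_closed e i d he hd := by
    obtain ⟨h, ℓ, hℓ⟩ := S.part_closed i _ _ hd (S.adj_basePort d)
    have hm : ¬Marked e (S.lab d.1 (S.basePort d.1 d.2)) := by
      rintro ⟨j, ℓ', ho, hj⟩
      rw [hℓ] at ho
      cases ho
      rw [he] at hj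
      cases hj
    change S.twist e d.1 (S.basePort d.1 d.2) ∈ S.part i
    rwa [twist, if_neg hm]

end Dart
end Switch

/-! ### Bounds on the conductance -/

section Conductance

variable {V V' : Type} [Fintype V] [Fintype V']

lemma cutEdges_compl [DecidableEq V] (G : SimpleGraph V) (U : Finset V) :
    cutEdges G Uᶜ = cutEdges G U := by
  unfold cutEdges
  rw [← Set.ncard_image_of_injective _ (Prod.swap_injective (α := V) (β := V))]
  congr 1
  ext ⟨a, b⟩
  simp only [Finset.mem_compl, Set.image_swap_eq_preimage_swap, Set.mem_preimage, Set.mem_ofPred_eq,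
    Prod.fst_swap, Prod.snd_swap, not_not, G.adj_comm a b]
  tauto

lemma vol_map (G : SimpleGraph V) (G' : SimpleGraph V') (f : G ≃g G') (U : Finset V) :
    vol G' (U.map f.toEquiv.toEmbedding) = vol G U := by
  unfold vol
  rw [Finset.sum_map]
  refine Finset.sum_congr rfl fun v _ => ?_
  exact (Nat.card_congr (f.mapNeighborSet v)).symm

lemma cutEdges_map (G : SimpleGraph V) (G' : SimpleGraph V') (f : G ≃g G') (U : Finset V) :
    cutEdges G' (U.map f.toEquiv.toEmbedding) = cutEdges G U := by
  unfold cutEdges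
  rw [← Set.ncard_image_of_injective _ (f.injective.prodMap f.injective)]
  congr 1
  ext ⟨a, b⟩
  obtain ⟨a, rfl⟩ := f.surjective a
  obtain ⟨b, rfl⟩ := f.surjective b
  have hmem : ∀ v, f v ∈ U.map f.toEquiv.toEmbedding ↔ v ∈ U := fun v =>
    Finset.mem_map' f.toEquiv.toEmbedding
  rw [show (f a, f b) = Prod.map f f (a, b) from rfl,
    (f.injective.prodMap f.injective).mem_set_image]
  exact and_congr (hmem a) (and_congr (not_congr (hmem b)) f.map_adj_iff)

/-- Needed because the graphs are built on `Node k s`, whereas networks live on `Fin m`. -/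
lemma conductance_congr (G : SimpleGraph V) (G' : SimpleGraph V') (f : G ≃g G') :
    conductance G = conductance G' := by
  classical
  unfold conductance
  refine Equiv.iInf_congr (f.toEquiv.finsetCongr.subtypeEquiv fun U => ?_) fun U => ?_
  · have h : (Finset.univ : Finset V') = f.toEquiv.finsetCongr Finset.univ := by simp
    rw [h, f.toEquiv.finsetCongr.injective.ne_iff]
    simp
  · have hc : (U.1.map f.toEquiv.toEmbedding)ᶜ = U.1ᶜ.map f.toEquiv.toEmbedding := by
      ext v
      obtain ⟨v, rfl⟩ := f.surjective v
      simp
    simp only [cutConductance, Equiv.subtypeEquiv_apply, Equiv.finsetCongr_apply]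
    rw [cutEdges_map, vol_map]
    congr 3
    convert vol_map G G' f U.1ᶜ using 2

lemma conductance_le_cutConductance (G : SimpleGraph V) (U : Finset V) (h : U.Nonempty)
    (h' : U ≠ Finset.univ) : conductance G ≤ cutConductance G U :=
  ciInf_le (Set.finite_range _).bddBelow
    (⟨U, h, h'⟩ : {U : Finset V // U.Nonempty ∧ U ≠ Finset.univ})

lemma vol_pos (G : SimpleGraph V) (hpos : ∀ v, 0 < (G.neighborSet v).ncard) {U : Finset V}
    (h : U.Nonempty) : 0 < vol G U :=
  Finset.sum_pos (fun v _ => hpos v) h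

/-- A lower bound on the conductance of a graph which consists of a hub and of small pieces such that
every set of vertices without the hub has a cut edge in each piece that it meets. -/
lemma le_conductance {κ : Type} [Nontrivial V] (G : SimpleGraph V) (hub : V) (γ : V → κ) (F D : ℕ)
    (hcut : ∀ U : Finset V, hub ∉ U → ∀ u ∈ U, ∃ a ∈ U, ∃ b ∉ U, G.Adj a b ∧ γ a = γ u)
    (hF : ∀ (i : κ) (T : Finset V), (∀ v ∈ T, v ≠ hub ∧ γ v = i) → T.card ≤ F)
    (hD : ∀ v ≠ hub, (G.neighborSet v).ncard ≤ D) (hpos : ∀ v, 0 < (G.neighborSet v).ncard) :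
    1 / ((F * D : ℕ) : ℝ) ≤ conductance G := by
  classical
  have key : ∀ U : Finset V, hub ∉ U → vol G U ≤ F * D * cutEdges G U := by
    intro U hU
    have h₁ : vol G U ≤ U.card * D :=
      Finset.sum_le_card_nsmul _ _ _ fun v hv => hD v fun h => hU (h ▸ hv)
    have h₂ : U.card ≤ F * (U.image γ).card := by
      refine Finset.card_le_mul_card_image U F fun i _ => hF i _ fun v hv => ?_
      rw [Finset.mem_filter] at hv
      exact ⟨fun h => hU (h ▸ hv.1), hv.2⟩
    -- A cut edge is charged to the piece of its end inside `U`, so different pieces account for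
    -- different cut edges.
    have h₃ : (U.image γ).card ≤ cutEdges G U := by
      rw [← Set.ncard_coe_finset]
      refine le_trans (Set.ncard_le_ncard (t := (fun e : V × V => γ e.1) ''
        {e : V × V | e.1 ∈ U ∧ e.2 ∉ U ∧ G.Adj e.1 e.2}) ?_ (Set.toFinite _)) (Set.ncard_image_le)
      intro i hi
      obtain ⟨u, hu, rfl⟩ := Finset.mem_image.1 hi
      obtain ⟨a, ha, b, hb, hab, hγ⟩ := hcut U hU u hu
      exact ⟨(a, b), ⟨ha, hb, hab⟩, hγ⟩
    calc vol G U ≤ U.card * D := h₁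
      _ ≤ F * cutEdges G U * D :=
        Nat.mul_le_mul_right _ (h₂.trans (Nat.mul_le_mul_left _ h₃))
      _ = F * D * cutEdges G U := by ring
  have hne : Nonempty {U : Finset V // U.Nonempty ∧ U ≠ Finset.univ} := by
    obtain ⟨v, hv⟩ := exists_ne hub
    refine ⟨⟨{hub}, Finset.singleton_nonempty _, fun h => hv ?_⟩⟩
    exact Finset.mem_singleton.1 (h ▸ Finset.mem_univ v)
  refine le_ciInf fun ⟨U, h₁, h₂⟩ => ?_
  have h₂' : Uᶜ.Nonempty := by
    rw [Finset.nonempty_iff_ne_empty]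
    simpa using h₂
  have hmin : min (vol G U) (vol G Uᶜ) ≤ F * D * cutEdges G U := by
    by_cases hU : hub ∈ U
    · refine (min_le_right _ _).trans ?_
      rw [← cutEdges_compl]
      exact key _ (by simpa using hU)
    · exact (min_le_left _ _).trans (key _ hU)
  have hpos' : 0 < min (vol G U) (vol G Uᶜ) := lt_min (vol_pos G hpos h₁) (vol_pos G hpos h₂')
  have hFD : 0 < F * D := Nat.pos_of_ne_zero fun h => by
    rw [h, zero_mul] at hmin
    omega
  unfold cutConductance
  rw [div_le_div_iff₀ (by exact_mod_cast hFD), one_mul, mul_comm]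
  · convert (Nat.cast_le (α := ℝ)).2 hmin using 1
    push_cast
    rfl
  · convert (Nat.cast_pos (α := ℝ)).2 hpos'

/-- An upper bound on the conductance in terms of one cut. -/
lemma conductance_le [DecidableEq V] (G : SimpleGraph V) (U : Finset V) (h : U.Nonempty)
    (h' : U ≠ Finset.univ) {a b : ℕ} (hb : 0 < b) (hcut : cutEdges G U ≤ a) (hU : b ≤ vol G U)
    (hU' : b ≤ vol G Uᶜ) : conductance G ≤ (a : ℝ) / b := by
  refine (conductance_le_cutConductance G U h h').trans ?_
  unfold cutConductance
  refine div_le_div₀ (by positivity) (by exact_mod_cast hcut) (by exact_mod_cast hb) ?_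
  refine Nat.cast_le.2 (le_min hU ?_)
  -- The two complements differ only in the decidability instance for equality of vertices.
  exact hU'.trans_eq (by congr!)

end Conductance

/-! ### Pairs of complete bipartite graphs around a hub -/

/-- The nodes: a hub `none`, and for each `i` two copies `(i, b)` of the vertex set of the complete
bipartite graph with sides `(i, b, c)` of size `s`. -/
abbrev Node (k s : ℕ) : Type := Option (Fin k × Bool × Bool × Fin s)

namespace Node

variable {k s : ℕ}

/-- Adjacency in the graph which consists of the complete bipartite graphs and of the edges between
the hub and the sides `(i, false, false)`. -/
def Adj : Node k s → Node k s → Prop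
  | none, none => False
  | none, some (_, b, c, _) => b = false ∧ c = false
  | some (_, b, c, _), none => b = false ∧ c = false
  | some (i, b, c, _), some (i', b', c', _) => i' = i ∧ b' = b ∧ c' = !c

/-- Exchange of the two copies. -/
def flip : Node k s → Node k s
  | none => none
  | some (i, b, c, x) => some (i, !b, c, x)

/-- The label of a pair of nodes on different sides for the same `i`. -/
def lab : Node k s → Node k s → Option (Fin k × (Fin s × Fin s))
  | some (i, _, false, x), some (i', _, true, y) => if i' = i then some (i, (x, y)) else none
  | some (i, _, true, x), some (i', _, false, y) => if i' = i then some (i, (y, x)) else none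
  | _, _ => none

lemma lab_symm (v w : Node k s) : lab v w = lab w v := by
  rcases v with _ | ⟨i, b, _ | _, x⟩ <;> rcases w with _ | ⟨i', b', _ | _, y⟩ <;>
    try rfl
  all_goals
    by_cases h : i' = i
    · simp [lab, h]
    · simp [lab, h, Ne.symm h]

lemma lab_flip (v w : Node k s) : lab v (flip w) = lab v w := by
  rcases v with _ | ⟨i, b, _ | _, x⟩ <;> rcases w with _ | ⟨i', b', _ | _, y⟩ <;> rfl

lemma lab_self (v : Node k s) : lab v v = none := by
  rcases v with _ | ⟨i, b, _ | _, x⟩ <;> rfl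

/-- Switching a label exchanges an edge of the first copy and the corresponding edge of the second
copy for two edges between the copies. -/
def switch (k s : ℕ) (hs : 0 < s) : Switch (Node k s) (Fin k) (Fin s × Fin s) where
  base :=
    { Adj := Adj
      symm := ⟨by
        rintro (_ | ⟨i, b, c, x⟩) (_ | ⟨i', b', c', y⟩) h
        · exact h
        · exact h
        · exact h
        · obtain ⟨rfl, rfl, rfl⟩ := h
          exact ⟨rfl, rfl, by simp⟩⟩
      loopless := ⟨by
        rintro (_ | ⟨i, b, c, x⟩) h
        · exact h
        · simpa using h.2.2⟩ }
  flip := flip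
  lab := lab
  flip_flip := by
    rintro (_ | ⟨i, b, c, x⟩)
    · rfl
    · simp [flip]
  lab_symm := lab_symm
  lab_flip := lab_flip
  lab_self := lab_self
  adj_flip := by
    rintro (_ | ⟨i, b, c, x⟩) (_ | ⟨i', b', c', y⟩) h hvw
    · exact hvw
    · simp [lab] at h
    · simp [lab] at h
    · obtain ⟨rfl, rfl, rfl⟩ := hvw
      exact ⟨rfl, rfl, rfl⟩
  hub := none
  part i := {v | ∃ c x, v = some (i, true, c, x)}
  part_nonempty i := ⟨some (i, true, false, ⟨0, hs⟩), _, _, rfl⟩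
  hub_notMem_part i := by simp
  part_closed := by
    rintro i _ (_ | ⟨i', b', c', y⟩) ⟨c, x, rfl⟩ h
    · exact absurd h.1 (by simp)
    · obtain ⟨rfl, rfl, rfl⟩ := h
      refine ⟨⟨_, _, rfl⟩, ?_⟩
      cases c <;> simp [lab]

variable (hs : 0 < s) (e : Fin k → Fin s × Fin s)

/-- The graph with switched labels `e`. -/
abbrev graph : SimpleGraph (Node k s) := (switch k s hs).graph fun i => some (e i)

lemma marked_iff (i : Fin k) (ℓ : Fin s × Fin s) :
    Switch.Marked (fun i => some (e i)) (some (i, ℓ)) ↔ e i = ℓ := by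
  constructor
  · rintro ⟨j, ℓ', h, h'⟩
    cases h
    exact Option.some.inj h'
  · rintro rfl
    exact ⟨i, e i, rfl, rfl⟩

lemma not_marked_none : ¬Switch.Marked (fun i => some (e i)) none := by
  rintro ⟨_, _, h, _⟩
  cases h

lemma graph_adj_hub (b c : Bool) (i : Fin k) (x : Fin s) :
    (graph hs e).Adj (some (i, b, c, x)) none ↔ b = false ∧ c = false := by
  have h : (switch k s hs).lab (some (i, b, c, x)) none = none := by cases c <;> rfl
  rw [Switch.graph_adj, Switch.twist, h, if_neg (not_marked_none e)]
  rfl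

lemma graph_adj_false_true (i i' : Fin k) (b b' : Bool) (x y : Fin s) :
    (graph hs e).Adj (some (i, b, false, x)) (some (i', b', true, y)) ↔
      i' = i ∧ (b' = b ↔ e i ≠ (x, y)) := by
  have h : (switch k s hs).lab (some (i, b, false, x)) (some (i', b', true, y)) =
    if i' = i then some (i, (x, y)) else none := rfl
  rw [Switch.graph_adj, Switch.twist, h]
  by_cases hi : i' = i
  · subst hi
    rw [if_pos rfl, marked_iff]
    by_cases he : e i' = (x, y)
    · rw [if_pos he]
      change (i' = i' ∧ (!b') = b ∧ true = !false) ↔ _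
      cases b <;> cases b' <;> simp [he]
    · rw [if_neg he]
      change (i' = i' ∧ b' = b ∧ true = !false) ↔ _
      cases b <;> cases b' <;> simp [he]
  · rw [if_neg hi, if_neg (not_marked_none e)]
    simp only [hi, false_and, iff_false]
    exact fun h => hi h.1

lemma graph_adj_same_side (i i' : Fin k) (b b' c : Bool) (x y : Fin s) :
    ¬(graph hs e).Adj (some (i, b, c, x)) (some (i', b', c, y)) := by
  have h : (switch k s hs).lab (some (i, b, c, x)) (some (i', b', c, y)) = none := by
    cases c <;> rfl
  rw [Switch.graph_adj, Switch.twist, h, if_neg (not_marked_none e)]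
  exact fun h => by simpa using h.2.2

/-- From every node of gadget `i` a path inside the gadget leads to the hub; `2 ≤ s` leaves room to
avoid the switched edges where needed. The form with a closed set `W` serves twice: for
connectedness, and for finding a cut edge in each gadget that a set without the hub meets. -/
lemma hub_mem_of_closed (hs₂ : 2 ≤ s) (W : Set (Node k s)) (i : Fin k)
    (hW : ∀ b c x, some (i, b, c, x) ∈ W → ∀ w, (graph hs e).Adj (some (i, b, c, x)) w → w ∈ W)
    (b c : Bool) (x : Fin s) (hx : some (i, b, c, x) ∈ W) : none ∈ W := by
  have : Nontrivial (Fin s) := Fin.nontrivial_iff_two_le.2 hs₂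
  obtain ⟨⟨x₀, y₀⟩, he⟩ : ∃ ℓ, e i = ℓ := ⟨_, rfl⟩
  have h₀₀ : ∀ x, some (i, false, false, x) ∈ W → none ∈ W := fun x hx =>
    hW _ _ _ hx _ ((graph_adj_hub hs e _ _ i x).2 ⟨rfl, rfl⟩)
  have h₀₁ : ∀ y, some (i, false, true, y) ∈ W → none ∈ W := fun y hy => by
    obtain ⟨x, hx⟩ := exists_ne x₀
    refine h₀₀ x (hW _ _ _ hy _ ((graph_adj_false_true hs e i i _ _ x y).2 ⟨rfl, ?_⟩).symm)
    simp [he, hx.symm]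
  have h₁₀ : some (i, true, false, x₀) ∈ W → none ∈ W := fun hx => by
    refine h₀₁ y₀ (hW _ _ _ hx _ ((graph_adj_false_true hs e i i _ _ x₀ y₀).2 ⟨rfl, ?_⟩))
    simp [he]
  have h₁₁ : ∀ y, some (i, true, true, y) ∈ W → none ∈ W := fun y hy => by
    by_cases h : y = y₀
    · refine h₀₀ x₀ (hW _ _ _ hy _ ((graph_adj_false_true hs e i i _ _ x₀ y).2 ⟨rfl, ?_⟩).symm)
      simp [he, h]
    · refine h₁₀ (hW _ _ _ hy _ ((graph_adj_false_true hs e i i _ _ x₀ y).2 ⟨rfl, ?_⟩).symm)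
      simp [he, Ne.symm h]
  match b, c with
  | false, false => exact h₀₀ x hx
  | false, true => exact h₀₁ x hx
  | true, true => exact h₁₁ x hx
  | true, false =>
    obtain ⟨y, hy⟩ := exists_ne y₀
    refine h₁₁ y (hW _ _ _ hx _ ((graph_adj_false_true hs e i i _ _ x y).2 ⟨rfl, ?_⟩))
    simp [he, hy.symm]

lemma graph_connected (hs₂ : 2 ≤ s) : (graph hs e).Connected := by
  have hub : ∀ v, (graph hs e).Reachable v none := by
    rintro (_ | ⟨i, b, c, x⟩)
    · exact SimpleGraph.Reachable.refl _
    · exact hub_mem_of_closed hs e hs₂ {w | (graph hs e).Reachable (some (i, b, c, x)) w} i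
        (fun _ _ _ h w hw => SimpleGraph.Reachable.trans h hw.reachable) b c x
        (SimpleGraph.Reachable.refl _)
  exact ⟨fun v w => (hub v).trans (hub w).symm⟩

lemma ncard_neighborSet (v : Node k s) :
    ((graph hs e).neighborSet v).ncard = ((switch k s hs).base.neighborSet v).ncard :=
  (Nat.card_congr ((switch k s hs).neighborEquiv _ v)).symm

lemma injective_some (i : Fin k) (b c : Bool) :
    Function.Injective fun y : Fin s => (some (i, b, c, y) : Node k s) := fun y y' h => by
  simpa using h

lemma le_ncard_neighborSet (i : Fin k) (b c : Bool) (x : Fin s) :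
    s ≤ ((graph hs e).neighborSet (some (i, b, c, x))).ncard := by
  rw [ncard_neighborSet]
  calc s = (Set.range fun y : Fin s => (some (i, b, !c, y) : Node k s)).ncard := by
        rw [← Set.image_univ, Set.ncard_image_of_injective _ (injective_some i b _)]
        simp
    _ ≤ _ := by
      refine Set.ncard_le_ncard ?_ (Set.toFinite _)
      rintro _ ⟨y, rfl⟩
      exact ⟨rfl, rfl, rfl⟩

lemma ncard_neighborSet_le (v : Node k s) (hv : v ≠ none) :
    ((graph hs e).neighborSet v).ncard ≤ s + 1 := by
  obtain ⟨⟨i, b, c, x⟩, rfl⟩ := Option.ne_none_iff_exists'.1 hv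
  rw [ncard_neighborSet]
  calc _ ≤ (insert none (Set.range fun y : Fin s => (some (i, b, !c, y) : Node k s))).ncard := by
        refine Set.ncard_le_ncard ?_ (Set.toFinite _)
        rintro (_ | ⟨i', b', c', y⟩) h
        · exact Set.mem_insert _ _
        · obtain ⟨rfl, rfl, rfl⟩ := h
          exact Set.mem_insert_of_mem _ ⟨y, rfl⟩
    _ ≤ (Set.range fun y : Fin s => (some (i, b, !c, y) : Node k s)).ncard + 1 :=
      Set.ncard_insert_le _ _
    _ = s + 1 := by
      rw [← Set.image_univ, Set.ncard_image_of_injective _ (injective_some i b _)]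
      simp

lemma ncard_neighborSet_pos (hk : 0 < k) (v : Node k s) :
    0 < ((graph hs e).neighborSet v).ncard := by
  rcases v with _ | ⟨i, b, c, x⟩
  · rw [Set.ncard_pos]
    exact ⟨some (⟨0, hk⟩, false, false, ⟨0, hs⟩),
      ((graph_adj_hub hs e false false ⟨0, hk⟩ ⟨0, hs⟩).2 ⟨rfl, rfl⟩).symm⟩
  · exact hs.trans_le (le_ncard_neighborSet hs e i b c x)

lemma eq_of_adj {i i' : Fin k} {b b' c c' : Bool} {x y : Fin s}
    (h : (graph hs e).Adj (some (i, b, c, x)) (some (i', b', c', y))) : i' = i := by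
  match c, c' with
  | false, false => exact absurd h (graph_adj_same_side hs e _ _ _ _ _ _ _)
  | true, true => exact absurd h (graph_adj_same_side hs e _ _ _ _ _ _ _)
  | false, true => exact ((graph_adj_false_true hs e _ _ _ _ _ _).1 h).1
  | true, false => exact ((graph_adj_false_true hs e _ _ _ _ _ _).1 h.symm).1.symm

lemma le_conductance_graph (hk : 0 < k) (hs₂ : 2 ≤ s) :
    1 / ((4 * s * (s + 1) : ℕ) : ℝ) ≤ conductance (graph hs e) := by
  have : Nontrivial (Node k s) :=
    ⟨none, some (⟨0, hk⟩, false, false, ⟨0, hs⟩), by simp⟩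
  -- The pieces are the gadgets: `4 s` nodes, each of degree at most `s + 1`.
  refine le_conductance (graph hs e) none (Option.map Prod.fst) (4 * s) (s + 1) ?_ ?_
    (ncard_neighborSet_le hs e) (ncard_neighborSet_pos hs e hk)
  · rintro U hU (_ | ⟨i, b, c, x⟩) hu
    · exact absurd hu hU
    · by_contra! hno
      refine hU (hub_mem_of_closed hs e hs₂ U i (fun b' c' x' h w hw => ?_) b c x hu)
      by_contra hwU
      exact hno _ h w hwU hw rfl
  · intro i T hT
    have hsub : T ⊆ Finset.univ.image fun a : Bool × Bool × Fin s =>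
        i.bind fun j => (some (j, a) : Node k s) := by
      intro v hv
      obtain ⟨hv₀, rfl⟩ := hT v hv
      obtain ⟨⟨j, a⟩, rfl⟩ := Option.ne_none_iff_exists'.1 hv₀
      exact Finset.mem_image.2 ⟨a, Finset.mem_univ _, rfl⟩
    refine (Finset.card_le_card hsub).trans (Finset.card_image_le.trans (le_of_eq ?_))
    simp
    ring

/-- One of the two copies of the complete bipartite graph for the index `i`. -/
def copy (i : Fin k) (b : Bool) : Finset (Node k s) :=
  Finset.univ.image fun a : Bool × Fin s => some (i, b, a)

lemma mem_copy (i j : Fin k) (b b' c : Bool) (x : Fin s) :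
    (some (j, b', c, x) : Node k s) ∈ copy i b ↔ j = i ∧ b' = b := by
  simp [copy, eq_comm]

lemma none_notMem_copy (i : Fin k) (b : Bool) : (none : Node k s) ∉ copy i b := by
  simp [copy]

lemma le_vol_copy (i : Fin k) (b : Bool) : 2 * s ^ 2 ≤ vol (graph hs e) (copy i b) := by
  calc 2 * s ^ 2 = (copy (k := k) (s := s) i b).card • s := by
        rw [copy, Finset.card_image_of_injective _ fun a a' h => by simpa using h]
        simp
        ring
    _ ≤ _ := Finset.card_nsmul_le_sum _ _ _ fun v hv => by
        obtain ⟨⟨c, x⟩, -, rfl⟩ := Finset.mem_image.1 hv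
        exact le_ncard_neighborSet hs e i b c x

/-- The second copy is not adjacent to the hub, so only the two switched edges leave it. -/
lemma cutEdges_copy_le (i : Fin k) : cutEdges (graph hs e) (copy i true) ≤ 2 := by
  refine le_trans (Set.ncard_le_ncard (t := {(some (i, true, false, (e i).1),
    some (i, false, true, (e i).2)), (some (i, true, true, (e i).2),
    some (i, false, false, (e i).1))}) ?_ (Set.toFinite _)) 
    ((Set.ncard_insert_le _ _).trans (by simp))
  rintro ⟨v, w⟩ ⟨hv, hw, h⟩
  obtain ⟨⟨c, x⟩, -, rfl⟩ := Finset.mem_image.1 hv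
  rcases w with _ | ⟨j, b, c', y⟩
  · exact absurd ((graph_adj_hub hs e _ _ _ _).1 h).1 (by simp)
  · have hj := eq_of_adj hs e h
    subst hj
    have hb : b = false := by simpa [mem_copy] using hw
    subst hb
    match c, c' with
    | false, false => exact absurd h (graph_adj_same_side hs e _ _ _ _ _ _ _)
    | true, true => exact absurd h (graph_adj_same_side hs e _ _ _ _ _ _ _)
    | false, true =>
      have := ((graph_adj_false_true hs e _ _ _ _ _ _).1 h).2
      simp only [Bool.false_eq_true, ne_eq, false_iff, not_not] at this
      simp [this]
    | true, false =>
      have := ((graph_adj_false_true hs e _ _ _ _ _ _).1 h.symm).2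
      simp only [Bool.true_eq_false, ne_eq, false_iff, not_not] at this
      simp [this]

lemma conductance_graph_le (hk : 0 < k) : conductance (graph hs e) ≤ 1 / (s : ℝ) ^ 2 := by
  let i : Fin k := ⟨0, hk⟩
  have h := conductance_le (graph hs e) (copy i true)
    ⟨some (i, true, false, ⟨0, hs⟩), (mem_copy _ _ _ _ _ _).2 ⟨rfl, rfl⟩⟩
    (fun h => none_notMem_copy (s := s) i true (h ▸ Finset.mem_univ _)) (a := 2) (b := 2 * s ^ 2)
    (by positivity) (cutEdges_copy_le hs e i) (le_vol_copy hs e i true)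
    -- The complement contains the first copy, whose volume is just as large.
    ((le_vol_copy hs e i false).trans (Finset.sum_le_sum_of_subset fun v hv => ?_))
  · refine h.trans (le_of_eq ?_)
    push_cast
    field_simp
  · obtain ⟨⟨c, x⟩, -, rfl⟩ := Finset.mem_image.1 hv
    rw [Finset.mem_compl]
    exact fun h => by simpa using ((mem_copy _ _ _ _ _ _).1 h).2

end Node

/-! ### Assembly: identifiers, parameters and constants -/

lemma exists_injective_mem {m : ℕ} (s : Set ℕ) (h : (m : ℕ∞) ≤ s.encard) :
    ∃ f : Fin m → ℕ, Function.Injective f ∧ ∀ i, f i ∈ s := by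
  obtain ⟨t, ht, hc⟩ := Set.exists_subset_encard_eq h
  have hfin : t.Finite := Set.finite_of_encard_eq_coe hc
  have : Finite t := hfin
  have hn : Nat.card t = m := by
    rw [Nat.card_coe_set_eq, Set.ncard, hc]
    rfl
  refine ⟨fun i => ((Finite.equivFinOfCardEq hn).symm i).1, ?_, fun i => ht (Subtype.property _)⟩
  exact Subtype.val_injective.comp (Equiv.injective _)

/-- The networks on which a broadcast algorithm needs many messages. -/
lemma exists_network {P : Type} [Nontrivial P] (A : Algorithm P) (k s : ℕ) (hk : 0 < k)
    (hs : 2 ≤ s) (I : Set ℕ) (hI : ((4 * k * s + 1 : ℕ) : ℕ∞) ≤ I.encard)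
    (hA : ∀ N : Network (4 * k * s + 1), (∀ v, N.id v ∈ I) → ∀ src p,
      3 / 4 ≤ successProb A N src p) :
    ∃ N : Network (4 * k * s + 1), (∀ v, N.id v ∈ I) ∧
      1 / (8 * (s : ℝ) ^ 2) ≤ conductance N.graph ∧ conductance N.graph ≤ 1 / (s : ℝ) ^ 2 ∧
      ∃ src p, ENNReal.ofReal (k * s ^ 2 / 32) ≤ expectedMessages A N src p := by
  have hs₀ : 0 < s := by omega
  obtain ⟨id, hinj, hid⟩ := exists_injective_mem I hI
  have hcard : Fintype.card (Node k s) = 4 * k * s + 1 := by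
    simp
    ring
  let ψ : Fin (4 * k * s + 1) ≃ Node k s := (Fintype.equivFinOfCardEq hcard).symm
  let S := (Node.switch k s hs₀).comap ψ
  let iso : ∀ e : Fin k → Fin s × Fin s, S.graph (fun i => some (e i)) ≃g Node.graph hs₀ e :=
    fun e => (Node.switch k s hs₀).comapIso ψ _
  let H := S.hiddenFamily id hinj fun e => (iso e).connected_iff.2 (Node.graph_connected hs₀ e hs)
  obtain ⟨p, q, hpq⟩ := exists_pair_ne P
  have : Nonempty (Fin s × Fin s) := ⟨(⟨0, hs₀⟩, ⟨0, hs₀⟩)⟩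
  obtain ⟨e, r, h⟩ := H.exists_expectedMessages_ge A hpq fun e r => hA _ hid _ _
  have hc : conductance (H.net e).graph = conductance (Node.graph hs₀ e) :=
    conductance_congr _ _ (iso e)
  refine ⟨H.net e, hid, ?_, ?_, H.src, r, le_trans (le_of_eq ?_) h⟩
  · rw [hc]
    refine le_trans ?_ (Node.le_conductance_graph hs₀ e hk hs)
    refine one_div_le_one_div_of_le (by positivity) ?_
    have : 4 * s * (s + 1) ≤ 8 * s ^ 2 := by nlinarith
    exact_mod_cast this
  · rw [hc]
    exact Node.conductance_graph_le hs₀ e hk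
  · simp [sq]

/-- The choice of the parameters. -/
lemma exists_parameters (n : ℕ) (α : ℝ) (h₁ : 1 / (n : ℝ) ^ 2 < α) (h₂ : α < 1 / 12 ^ 2)
    (hn : 0 < n) :
    ∃ k s : ℕ, 0 < k ∧ 2 ≤ s ∧ k * s ≤ n ∧ n ≤ 2 * (k * s) ∧ α ≤ 1 / (s : ℝ) ^ 2 ∧
      1 / (s : ℝ) ^ 2 ≤ 2 * α := by
  have hn' : (0 : ℝ) < n := by exact_mod_cast hn
  have hα : 0 < α := lt_trans (by positivity) h₁
  -- The parameters are `s = ⌊β⌋` and `k = n / s`, rounded down. The lower bound on `α` gives `s ≤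
  -- n`, so `k > 0`; the upper bound gives `s ≥ 12`.
  set β := (Real.sqrt α)⁻¹ with hβ
  have hβ₀ : 0 < β := by positivity
  have hβ₂ : α * β ^ 2 = 1 := by
    rw [hβ, inv_pow, Real.sq_sqrt hα.le, mul_inv_cancel₀ hα.ne']
  have hβn : β < n := by
    refine lt_of_pow_lt_pow_left₀ 2 hn'.le ?_
    rw [div_lt_iff₀ (by positivity)] at h₁
    exact lt_of_mul_lt_mul_left (hβ₂.trans_lt h₁) hα.le
  have hβ₁₂ : 12 < β := by
    refine lt_of_pow_lt_pow_left₀ 2 hβ₀.le ?_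
    nlinarith
  have hfl : (⌊β⌋₊ : ℝ) ≤ β := Nat.floor_le hβ₀.le
  have hfl' : β < ⌊β⌋₊ + 1 := Nat.lt_floor_add_one β
  set s := ⌊β⌋₊
  have hs : 12 ≤ s := Nat.le_floor (by exact_mod_cast hβ₁₂.le)
  have hs' : (12 : ℝ) ≤ s := by exact_mod_cast hs
  have hsn : s ≤ n := by exact_mod_cast hfl.trans hβn.le
  have hk : 0 < n / s := Nat.div_pos hsn (by omega)
  refine ⟨n / s, s, hk, by omega, Nat.div_mul_le_self n s, ?_, ?_, ?_⟩
  · have h := Nat.lt_div_mul_add (a := n) (b := s) (by omega)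
    have : s ≤ n / s * s := Nat.le_mul_of_pos_left s hk
    omega
  · rw [le_div_iff₀ (by positivity), ← hβ₂]
    gcongr
  -- `β < s + 1` and `(s + 1)² ≤ 2 s²` because `s ≥ 12`.
  · rw [div_le_iff₀ (by positivity), ← hβ₂]
    nlinarith

end BroadcastLB

end

open BroadcastLB in
theorem mainTheorem4 :
    ∃ c₁ c₂ c₃ c₄ c₅ : ℝ, 0 < c₁ ∧ 0 < c₂ ∧ 0 < c₃ ∧ 0 < c₄ ∧ 0 < c₅ ∧
      ∀ (P : Type) [Nontrivial P] (I : ℕ → Set ℕ), (∀ m : ℕ, (m : ℕ∞) ≤ (I m).encard) →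
      ∀ A : Algorithm P, IsBroadcastAlgorithm I A →
      ∃ n₀ : ℕ, ∀ n : ℕ, n₀ ≤ n →
      ∀ α : ℝ, 1 / (n : ℝ) ^ 2 < α → α < 1 / 12 ^ 2 →
      ∃ (m : ℕ) (N : Network m),
        (∀ v, N.id v ∈ I m) ∧
        c₁ * n ≤ m ∧ (m : ℝ) ≤ c₂ * n ∧
        c₃ * α ≤ conductance N.graph ∧ conductance N.graph ≤ c₄ * α ∧
        ∃ (src : Fin m) (p : P),
          ENNReal.ofReal (c₅ * (n / Real.sqrt (conductance N.graph))) ≤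
            expectedMessages A N src p := by
  -- With `m = 4 k s + 1` and `n / 2 ≤ k s ≤ n`, one has `2 n ≤ m ≤ 5 n`. The conductance lies
  -- between `1 / (8 s²)` and `1 / s²`, where `α ≤ 1 / s² ≤ 2 α`. Finally `n / √φ ≤ 3 s n ≤ 6 k s²`,
  -- and `6 / 192 = 1 / 32`.
  refine ⟨2, 5, 1 / 8, 2, 1 / 192, by norm_num, by norm_num, by norm_num, by norm_num,
    by norm_num, fun P _ I hI A ⟨δ, hδ, hA⟩ => ?_⟩
  obtain ⟨n₀, hn₀⟩ := Filter.eventually_atTop.1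
    (hδ.eventually_le_const (show (0 : ℝ) < 1 / 4 by norm_num))
  refine ⟨n₀ + 1, fun n hn α h₁ h₂ => ?_⟩
  obtain ⟨k, s, hk, hs, hks, hks', hα, hα'⟩ := exists_parameters n α h₁ h₂ (by omega)
  have hm : 2 * n ≤ 4 * k * s + 1 := by nlinarith
  have hm' : 4 * k * s + 1 ≤ 5 * n := by nlinarith
  obtain ⟨N, hid, hφ, hφ', src, p, hmsg⟩ := exists_network A k s hk hs (I (4 * k * s + 1)) (hI _)
    fun N hN src p => by
      have := hA _ N hN src p
      have := hn₀ (4 * k * s + 1) (by omega)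
      linarith
  refine ⟨4 * k * s + 1, N, hid, by exact_mod_cast hm, by exact_mod_cast hm', ?_,
    hφ'.trans hα', src, p, le_trans (ENNReal.ofReal_le_ofReal ?_) hmsg⟩
  · refine le_trans (le_trans (mul_le_mul_of_nonneg_left hα (by norm_num)) (le_of_eq ?_)) hφ
    field_simp
  · have hs₀ : (0 : ℝ) < s := by exact_mod_cast (by omega : 0 < s)
    -- `3` is a rational upper bound for `√8`.
    have hsqrt : 1 / (3 * (s : ℝ)) ≤ Real.sqrt (conductance N.graph) := by
      refine Real.le_sqrt_of_sq_le (le_trans ?_ hφ)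
      rw [div_pow, one_pow]
      exact one_div_le_one_div_of_le (by positivity) (by nlinarith [sq_nonneg (s : ℝ)])
    have hdiv : (n : ℝ) / Real.sqrt (conductance N.graph) ≤ n * (3 * s) := by
      refine (div_le_div_of_nonneg_left (by positivity) (by positivity) hsqrt).trans (le_of_eq ?_)
      field_simp
    have hnks : (n : ℝ) ≤ 2 * (k * s) := by exact_mod_cast hks'
    nlinarith [mul_le_mul_of_nonneg_right hnks hs₀.le]
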